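/- A sequence $S=(d_1,\dots,d_n)$ of non-negative integers is graphical if there is a simple graph of order $n$ with degree sequence $S$ (a realization of $S$), and it is potentially $H$-graphical if some realization of $S$ contains the graph $H$ as a subgraph. Write $\sigma(S)=d_1+\dots+d_n$, and let $\sigma(H,n)$ be the minimum even integer $l$ such that every $n$-term graphical sequence $S$ with $\sigma(S)\ge l$ is potentially $H$-graphical. Let $K_{3,1,1}$ be the complete 3-partite graph with partition sizes $3,1,1$. For $n=5$ and for all $n\ge 7$, $$\sigma(K_{3,1,1},n)=4n-2.$$ For $n=6$, if $S$ is a 6-term graphical sequence with $\sigma(S)\ge 22$, then either $S$ is potentially $K_{3,1,1}$-graphical or $S=(4,4,4,4,4,4)$; the sequence $(4,4,4,4,4,4)$ is graphical but not potentially $K_{3,1,1}$-graphical. Thus $\sigma(K_{3,1,1},6)=26$. -/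

import Mathlib

open SimpleGraph

/-- `G` realizes `S`: the degree of the `i`-th vertex of `G` is the `i`-th term of `S`. -/
def Realizes {n : ℕ} (G : SimpleGraph (Fin n)) (S : Fin n → ℕ) : Prop :=
  ∀ i, (G.neighborSet i).ncard = S i

/-- An `n`-term sequence is graphical if some simple graph of order `n` realizes it. -/
def IsGraphical {n : ℕ} (S : Fin n → ℕ) : Prop :=
  ∃ G : SimpleGraph (Fin n), Realizes G S

/-- `S` is potentially `H`-graphical: some realization of `S` contains `H` as a
(not necessarily induced) subgraph. -/
def IsPotentially {W : Type*} (H : SimpleGraph W) {n : ℕ} (S : Fin n → ℕ) : Prop :=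
  ∃ G : SimpleGraph (Fin n), Realizes G S ∧ H.IsContained G

/-- `σ(H, n) = m`: the number `m` is the least even `l` such that every `n`-term graphical
sequence with sum at least `l` is potentially `H`-graphical. -/
def IsPotentialNumber {W : Type*} (H : SimpleGraph W) (n m : ℕ) : Prop :=
  IsLeast {l : ℕ | Even l ∧
    ∀ S : Fin n → ℕ, IsGraphical S → l ≤ ∑ i, S i → IsPotentially H S} m

/-- The complete 3-partite graph with partition sizes `p, 1, 1`. -/
abbrev Kp11 (p : ℕ) : SimpleGraph (Σ i : Fin 3, Fin (![p, 1, 1] i)) :=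
  completeMultipartiteGraph fun i : Fin 3 => Fin (![p, 1, 1] i)

/-! A copy of `K_{3,1,1}` is a book: a spine edge with three common neighbours, its pages. The upper
bound is `bookRealizable`, by induction on the order `n`. Graphs live on subsets `A` of a fixed
vertex type, so deleting a vertex does not change the type.

On five vertices, degree sum 18 forces two vertices of degree 4, which span a book. On `n + 1`
vertices let `w` have minimum degree `d`. If deleting `w` leaves degree sum at least `4n - 2`,
induction gives a book and `w` is reattached to its old neighbours; the 4-regular exception on six
vertices is repaired by `exists_hasBook_of_six`. Otherwise `d` is 3 or 4. If `d = 4`, parity makes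
the graph 4-regular, and `exists_regular_hasBook` applies once there are seven vertices.

If `d = 3`, the sum is `4n + 2` and plain deletion loses 2 too much. Unless a book appears, a
switching makes two neighbours `p`, `q` of `w` non-adjacent (`hasBook_or_nonadjacent_neighbors`),
and `w` is replaced by the edge `p q`. In the realization given by induction, `w` is put back by
subdividing an edge and joining it to the third neighbour `r`; the edge must miss `r` and spare some
book (`exists_edge_avoiding`).

For sharpness, both spine ends have degree at least 4, but a wheel has at most one such vertex and
degree sum `4n - 4`. -/

set_option linter.unusedSectionVars false

/-- The degree of `v` in `G`, as in `Realizes`. -/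
noncomputable def vdeg {V : Type*} (G : SimpleGraph V) (v : V) : ℕ := (G.neighborSet v).ncard

open Classical in
/-- `1` if `v` and `x` are adjacent, and `0` otherwise. -/
noncomputable def adjIndicator {V : Type*} (G : SimpleGraph V) (v x : V) : ℕ :=
  if G.Adj v x then 1 else 0

/-- All edges of `G` lie inside `A`. -/
def SupportedOn {V : Type*} (A : Finset V) (G : SimpleGraph V) : Prop :=
  ∀ x y, G.Adj x y → x ∈ A ∧ y ∈ A

/-- `u v` is an edge with the three common neighbours `x`, `y`, `z`. -/
structure IsBook {V : Type*} (G : SimpleGraph V) (u v x y z : V) : Prop where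
  uv : G.Adj u v
  ux : G.Adj u x
  uy : G.Adj u y
  uz : G.Adj u z
  vx : G.Adj v x
  vy : G.Adj v y
  vz : G.Adj v z
  xy : x ≠ y
  xz : x ≠ z
  yz : y ≠ z

/-- `G` contains an edge with three common neighbours, that is, a copy of `K_{3,1,1}`. -/
def HasBook {V : Type*} (G : SimpleGraph V) : Prop := ∃ u v x y z, IsBook G u v x y z

/-- The star joining `w` to the vertices of `J`. -/
def starAt {V : Type*} (w : V) (J : Finset V) : SimpleGraph V where
  Adj x y := x ≠ y ∧ (x = w ∧ y ∈ J ∨ y = w ∧ x ∈ J)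
  symm := ⟨fun _ _ h => ⟨h.1.symm, h.2.symm⟩⟩
  loopless := ⟨fun _ h => h.1 rfl⟩

/-- `G` with all edges at `w` removed. -/
def isolate {V : Type*} (G : SimpleGraph V) (w : V) : SimpleGraph V where
  Adj x y := G.Adj x y ∧ x ≠ w ∧ y ≠ w
  symm := ⟨fun _ _ h => ⟨h.1.symm, h.2.2, h.2.1⟩⟩
  loopless := ⟨fun _ h => h.1.ne rfl⟩

theorem IsBook.mono {V : Type*} {G H : SimpleGraph V} {u v x y z : V} (h : IsBook G u v x y z)
    (hle : G ≤ H) : IsBook H u v x y z :=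
  ⟨hle h.uv, hle h.ux, hle h.uy, hle h.uz, hle h.vx, hle h.vy, hle h.vz, h.xy, h.xz, h.yz⟩

theorem HasBook.mono {V : Type*} {G H : SimpleGraph V} (h : HasBook G) (hle : G ≤ H) :
    HasBook H := by
  obtain ⟨u, v, x, y, z, h⟩ := h
  exact ⟨u, v, x, y, z, h.mono hle⟩

/-! ### Books and degree bookkeeping under edge operations -/

section
variable {V : Type*}

/-- The two singleton classes are the spine and the class of size three the pages. Vertices in
different classes are adjacent, hence distinct, so only the pages need explicit inequalities. -/
theorem isContained_iff_hasBook {G : SimpleGraph V} : (Kp11 3).IsContained G ↔ HasBook G := by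
  constructor
  · rintro ⟨f⟩
    have hadj : ∀ {a b : Σ i : Fin 3, Fin (![3, 1, 1] i)}, a.1 ≠ b.1 → G.Adj (f a) (f b) :=
      fun h => f.toHom.map_adj h
    have hinj : Function.Injective f := f.injective
    let p (i : Fin 3) : Σ i : Fin 3, Fin (![3, 1, 1] i) := ⟨0, i⟩
    have hp : ∀ i j, i ≠ j → f (p i) ≠ f (p j) := by
      intro i j hij h
      have := hinj h
      exact hij (eq_of_heq (Sigma.mk.inj this).2)
    refine ⟨f ⟨1, (0 : Fin 1)⟩, f ⟨2, (0 : Fin 1)⟩, f (p 0), f (p 1), f (p 2), ?_⟩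
    constructor <;> first | (apply hadj; simp [p]) | (apply hp; decide)
  · rintro ⟨u, v, x, y, z, h⟩
    let g : (Σ i : Fin 3, Fin (![3, 1, 1] i)) → V := fun a =>
      match a with
      | ⟨0, i⟩ => ![x, y, z] i
      | ⟨1, _⟩ => u
      | ⟨2, _⟩ => v
    have key : ∀ a b : Σ i : Fin 3, Fin (![3, 1, 1] i),
        (a.1 ≠ b.1 → G.Adj (g a) (g b)) ∧ (g a = g b → a = b) := by
      have h1 := h.uv; have h2 := h.ux; have h3 := h.uy; have h4 := h.uz
      have h5 := h.vx; have h6 := h.vy; have h7 := h.vz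
      have h8 := h.xy; have h9 := h.xz; have h10 := h.yz
      have e1 := h1.ne; have e2 := h2.ne; have e3 := h3.ne; have e4 := h4.ne
      have e5 := h5.ne; have e6 := h6.ne; have e7 := h7.ne
      rintro ⟨i, a⟩ ⟨j, b⟩
      fin_cases i <;> fin_cases j <;> (try change Fin 3 at a) <;> (try change Fin 3 at b) <;>
        (try change Fin 1 at a) <;> (try change Fin 1 at b) <;>
        fin_cases a <;> fin_cases b <;>
        simp [g, h1, h2, h3, h4, h5, h6, h7, h1.symm, h2.symm, h3.symm, h4.symm, h5.symm,
          h6.symm, h7.symm, h8, h9, h10, h8.symm, h9.symm, h10.symm, e1, e2, e3, e4, e5, e6, e7,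
          e1.symm, e2.symm, e3.symm, e4.symm, e5.symm, e6.symm, e7.symm]
    exact ⟨⟨⟨g, fun {a b} hab => (key a b).1 hab⟩, fun a b hab => (key a b).2 hab⟩⟩

variable [Fintype V] [DecidableEq V]

theorem vdeg_eq_sum (G : SimpleGraph V) (v : V) : vdeg G v = ∑ x, adjIndicator G v x := by
  classical
  simp only [adjIndicator]
  rw [Finset.sum_boole, Nat.cast_id, vdeg, Set.ncard_eq_toFinset_card']
  congr 1
  ext; simp

theorem vdeg_le_card {G : SimpleGraph V} {v : V} {J : Finset V} (h : ∀ x, G.Adj v x → x ∈ J) :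
    vdeg G v ≤ J.card := by
  rw [vdeg, ← Set.ncard_coe_finset]
  exact Set.ncard_le_ncard (fun x hx => h x hx) J.finite_toSet

theorem card_le_vdeg {G : SimpleGraph V} {v : V} {J : Finset V} (h : ∀ x ∈ J, G.Adj v x) :
    J.card ≤ vdeg G v := by
  rw [vdeg, ← Set.ncard_coe_finset]
  exact Set.ncard_le_ncard (fun x hx => h x hx) (Set.toFinite _)

theorem exists_adj_not_mem {G : SimpleGraph V} {v : V} {J : Finset V} (h : J.card < vdeg G v) :
    ∃ x, G.Adj v x ∧ x ∉ J := by
  by_contra! hc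
  exact absurd (vdeg_le_card hc) (by omega)

theorem exists_neighbors (G : SimpleGraph V) (v : V) :
    ∃ J : Finset V, (∀ x, x ∈ J ↔ G.Adj v x) ∧ J.card = vdeg G v := by
  classical
  have h : ∀ x, x ∈ Finset.univ.filter (G.Adj v) ↔ G.Adj v x := by simp
  exact ⟨_, h, le_antisymm (card_le_vdeg fun x hx => (h x).1 hx)
    (vdeg_le_card fun x hx => (h x).2 hx)⟩

theorem adj_of_vdeg_eq {G : SimpleGraph V} {v : V} {J : Finset V} (h : ∀ x, G.Adj v x → x ∈ J)
    (hc : J.card ≤ vdeg G v) {x : V} (hx : x ∈ J) : G.Adj v x := by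
  obtain ⟨K, hK, hKc⟩ := exists_neighbors G v
  have : K = J := Finset.eq_of_subset_of_card_le (fun y hy => h y ((hK y).1 hy)) (by omega)
  exact (hK x).1 (this ▸ hx)

theorem vdeg_eq_zero {G : SimpleGraph V} {A : Finset V} (hG : SupportedOn A G) {v : V}
    (hv : v ∉ A) : vdeg G v = 0 := by
  have := vdeg_le_card (G := G) (v := v) (J := ∅) fun x hx => absurd (hG _ _ hx).1 hv
  simpa using this

theorem sum_vdeg {G : SimpleGraph V} {A : Finset V} (hG : SupportedOn A G) :
    ∑ v ∈ A, vdeg G v = ∑ v, vdeg G v :=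
  Finset.sum_subset (Finset.subset_univ _) fun _ _ h => vdeg_eq_zero hG h

theorem even_sum_vdeg (G : SimpleGraph V) : Even (∑ v, vdeg G v) := by
  classical
  have h : ∀ v, vdeg G v = G.degree v := fun v => by
    rw [vdeg, Set.ncard_eq_toFinset_card', ← G.card_neighborFinset_eq_degree]; rfl
  simp only [h, G.sum_degrees_eq_twice_card_edges, even_two_mul]

theorem vdeg_sup_edge {G : SimpleGraph V} {a b : V} (hab : a ≠ b) (h : ¬ G.Adj a b) (v : V) :
    vdeg (G ⊔ edge a b) v = vdeg G v + (if v = a then 1 else 0) + (if v = b then 1 else 0) := by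
  have key : ∀ x, adjIndicator (G ⊔ edge a b) v x = adjIndicator G v x +
      (if x = b then (if v = a then 1 else 0) else 0) +
      (if x = a then (if v = b then 1 else 0) else 0) := by
    intro x
    have := G.adj_comm a b
    simp only [adjIndicator, sup_adj, edge_adj]
    grind
  rw [vdeg_eq_sum, vdeg_eq_sum, Finset.sum_congr rfl fun x _ => key x, Finset.sum_add_distrib,
    Finset.sum_add_distrib, Finset.sum_ite_eq', Finset.sum_ite_eq']
  simp

theorem vdeg_sdiff_edge {G : SimpleGraph V} {a b : V} (h : G.Adj a b) (v : V) :
    vdeg (G \ edge a b) v + (if v = a then 1 else 0) + (if v = b then 1 else 0) = vdeg G v := by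
  rw [← vdeg_sup_edge h.ne (by simp [edge_adj, h.ne])]
  congr 1
  exact sdiff_sup_cancel ((edge_le_iff G).2 (Or.inr h))

theorem vdeg_sup_star {G : SimpleGraph V} {w : V} {J : Finset V} (hw : w ∉ J)
    (hG : ∀ x, ¬ G.Adj w x) (v : V) :
    vdeg (G ⊔ starAt w J) v =
      vdeg G v + if v = w then J.card else if v ∈ J then 1 else 0 := by
  have hG' : ∀ x, ¬ G.Adj x w := fun x h => hG x h.symm
  rw [vdeg_eq_sum, vdeg_eq_sum]
  by_cases hv : v = w
  · subst hv
    have key : ∀ x, adjIndicator (G ⊔ starAt v J) v x =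
        adjIndicator G v x + (if x ∈ J then 1 else 0) := by
      intro x
      simp only [adjIndicator, sup_adj, starAt]
      grind
    rw [Finset.sum_congr rfl fun x _ => key x, Finset.sum_add_distrib]
    simp
  · have key : ∀ x, adjIndicator (G ⊔ starAt w J) v x =
        adjIndicator G v x + (if x = w then (if v ∈ J then 1 else 0) else 0) := by
      intro x
      simp only [adjIndicator, sup_adj, starAt]
      grind
    rw [Finset.sum_congr rfl fun x _ => key x, Finset.sum_add_distrib, Finset.sum_ite_eq']
    simp [hv]

theorem isolate_sup_star {G : SimpleGraph V} {w : V} {J : Finset V}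
    (hJ : ∀ x, x ∈ J ↔ G.Adj w x) : isolate G w ⊔ starAt w J = G := by
  ext x y
  have := G.symm.symm x y
  have h1 : ¬ G.Adj w w := G.irrefl
  simp only [sup_adj, starAt, isolate, hJ]
  constructor
  · rintro (h | ⟨h, ⟨rfl, h'⟩ | ⟨rfl, h'⟩⟩)
    exacts [h.1, h', h'.symm]
  · intro h
    have := h.ne
    have := h.symm
    by_cases x = w <;> by_cases y = w <;> simp_all

theorem vdeg_isolate {G : SimpleGraph V} {w : V} {J : Finset V}
    (hJ : ∀ x, x ∈ J ↔ G.Adj w x) (v : V) :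
    vdeg (isolate G w) v + (if v = w then J.card else if v ∈ J then 1 else 0) = vdeg G v := by
  rw [← vdeg_sup_star (by simp [hJ]) (by simp [isolate]), isolate_sup_star hJ]

theorem sum_vdeg_isolate {G : SimpleGraph V} {w : V} {J : Finset V}
    (hJ : ∀ x, x ∈ J ↔ G.Adj w x) :
    ∑ v, vdeg (isolate G w) v + 2 * J.card = ∑ v, vdeg G v := by
  have hw : w ∉ J := by simp [hJ]
  have : ∀ v, (if v = w then J.card else if v ∈ J then 1 else 0) =
      (if v = w then J.card else 0) + if v ∈ J then 1 else 0 := by grind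
  rw [← Finset.sum_congr rfl fun v _ => vdeg_isolate hJ v, Finset.sum_add_distrib,
    Finset.sum_congr rfl fun v _ => this v, Finset.sum_add_distrib, Finset.sum_ite_eq']
  simp
  ring

theorem SupportedOn.sdiff {A : Finset V} {G : SimpleGraph V} (h : SupportedOn A G)
    (H : SimpleGraph V) : SupportedOn A (G \ H) := fun x y hxy => h x y hxy.1

theorem SupportedOn.sup_edge {A : Finset V} {G : SimpleGraph V} (h : SupportedOn A G) {a b : V}
    (ha : a ∈ A) (hb : b ∈ A) : SupportedOn A (G ⊔ edge a b) := by
  intro x y hxy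
  simp only [sup_adj, edge_adj] at hxy
  have := h x y
  grind

theorem SupportedOn.sup_star {A : Finset V} {G : SimpleGraph V} (h : SupportedOn A G) {w : V}
    {J : Finset V} (hJ : J ⊆ A) : SupportedOn (insert w A) (G ⊔ starAt w J) := by
  intro x y hxy
  simp only [sup_adj, starAt] at hxy
  have := h x y
  grind

theorem SupportedOn.isolate {A : Finset V} {G : SimpleGraph V} (h : SupportedOn A G) (w : V) :
    SupportedOn (A.erase w) (isolate G w) := by
  intro x y hxy
  have := h x y hxy.1
  exact ⟨Finset.mem_erase.2 ⟨hxy.2.1, this.1⟩, Finset.mem_erase.2 ⟨hxy.2.2, this.2⟩⟩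

end

/-! ### Edges that a book can spare -/

section
variable {V : Type*} [Fintype V] [DecidableEq V]

theorem IsBook.rotate {G : SimpleGraph V} {u v x y z : V} (h : IsBook G u v x y z) :
    IsBook G u v y z x :=
  ⟨h.uv, h.uy, h.uz, h.ux, h.vy, h.vz, h.vx, h.yz, h.xy.symm, h.xz.symm⟩

theorem IsBook.swap {G : SimpleGraph V} {u v x y z : V} (h : IsBook G u v x y z) :
    IsBook G v u x y z :=
  ⟨h.uv.symm, h.vx, h.vy, h.vz, h.ux, h.uy, h.uz, h.xy, h.xz, h.yz⟩

/-- Deleting an edge that leaves at least one endpoint of every edge of a book untouched. -/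
theorem IsBook.sdiff_edge {G : SimpleGraph V} {u v x y z : V} (h : IsBook G u v x y z) {a b : V}
    (hab : ∀ s t, s = u ∨ s = v → t = v ∨ t = x ∨ t = y ∨ t = z →
      ¬ (s = a ∧ t = b) ∧ ¬ (s = b ∧ t = a)) :
    IsBook (G \ edge a b) u v x y z := by
  obtain ⟨h1, h2, h3, h4, h5, h6, h7, h8, h9, h10⟩ := h
  have key : ∀ s t, s = u ∨ s = v → t = v ∨ t = x ∨ t = y ∨ t = z → G.Adj s t →
      (G \ edge a b).Adj s t := by
    intro s t hs ht hst
    have := hab s t hs ht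
    simp only [sdiff_adj, edge_adj]
    tauto
  constructor <;> first | assumption | (apply key <;> simp [*])

/-- A page not adjacent only to the spine and to `r` supplies an edge that avoids `r` and the
book. -/
theorem IsBook.page_edge {G : SimpleGraph V} {u v x y z r : V} (h : IsBook G u v x y z)
    (hx : x ≠ r) (hno : ¬ ∃ a b, G.Adj a b ∧ a ≠ r ∧ b ≠ r ∧ HasBook (G \ edge a b)) {t : V}
    (ht : G.Adj x t) : t = u ∨ t = v ∨ t = r := by
  by_contra! hc
  refine hno ⟨x, t, ht, hx, hc.2.2, u, v, x, y, z, h.sdiff_edge ?_⟩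
  have h1 := h.ux.ne
  have h2 := h.vx.ne
  grind

/-- A page `x` or `y` with a neighbour outside `u`, `v`, `r` supplies the edge. Otherwise both are
adjacent to `r`, so `r v` is a spine with pages `u`, `x`, `y`, and this book does not use `u x`. -/
theorem exists_edge_avoiding_of_page {G : SimpleGraph V} {u v x y r : V}
    (h : IsBook G u v x y r) (hdx : 3 ≤ vdeg G x) (hdy : 3 ≤ vdeg G y) :
    ∃ a b, G.Adj a b ∧ a ≠ r ∧ b ≠ r ∧ HasBook (G \ edge a b) := by
  by_contra hno
  have key : ∀ s, 3 ≤ vdeg G s → (∀ t, G.Adj s t → t = u ∨ t = v ∨ t = r) → G.Adj s r := by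
    intro s hs hst
    obtain ⟨t, hst', ht⟩ := exists_adj_not_mem (G := G) (v := s) (J := {u, v})
      (Finset.card_le_two.trans_lt hs)
    have := hst t hst'
    grind
  have hx := key x hdx fun t ht => h.page_edge h.xz hno ht
  have hy := key y hdy fun t ht => h.rotate.page_edge h.yz hno ht
  refine hno ⟨u, x, h.ux, h.uz.ne, h.xz, r, v, u, x, y, ?_⟩
  refine IsBook.sdiff_edge ⟨h.vz.symm, h.uz.symm, hx.symm, hy.symm, h.uv.symm, h.vx, h.vy,
    h.ux.ne, h.uy.ne, h.xy⟩ ?_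
  have h1 := h.uv.ne
  have h2 := h.uz.ne
  have h3 := h.xz
  have h4 := h.vx.ne
  grind

/-- The page `x` has a third neighbour off the spine; that edge is not in the book and misses `r`.
-/
theorem exists_edge_avoiding_of_spine {G : SimpleGraph V} {u v x y z r : V}
    (h : IsBook G u v x y z) (hr : r = u ∨ r = v) (hdx : 3 ≤ vdeg G x) :
    ∃ a b, G.Adj a b ∧ a ≠ r ∧ b ≠ r ∧ HasBook (G \ edge a b) := by
  by_contra hno
  obtain ⟨t, ht, htJ⟩ := exists_adj_not_mem (G := G) (v := x) (J := {u, v})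
    (Finset.card_le_two.trans_lt hdx)
  have hx : x ≠ r := by
    have h1 := h.ux.ne
    have h2 := h.vx.ne
    grind
  have := h.page_edge hx hno ht
  grind

/-- Here `r` can replace `v` on the spine, which frees the edge `v x`. -/
theorem exists_edge_avoiding_of_adj_spine {G : SimpleGraph V} {u v x y z r : V}
    (h : IsBook G u v x y z) (hv : r ≠ v) (hx : G.Adj r x) (hy : G.Adj r y) (hz : G.Adj r z)
    (hu : G.Adj r u) : ∃ a b, G.Adj a b ∧ a ≠ r ∧ b ≠ r ∧ HasBook (G \ edge a b) := by
  refine ⟨v, x, h.vx, hv.symm, hx.ne.symm, r, u, x, y, z, ?_⟩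
  refine IsBook.sdiff_edge ⟨hu, hx, hy, hz, h.ux, h.uy, h.uz, h.xy, h.xz, h.yz⟩ ?_
  have h1 := h.uv.ne
  have h2 := h.vx.ne
  have h3 := h.ux.ne
  have h4 := hx.ne
  have h5 := h.vy.ne
  have h6 := h.vz.ne
  grind

/-- In a graph with a book, many edges and all degrees except that of `r` at least three, some
edge avoids `r` and some book. -/
theorem exists_edge_avoiding {G : SimpleGraph V} {A : Finset V} {r : V} (hG : SupportedOn A G)
    (hr : r ∈ A) (hd : ∀ v ∈ A, v ≠ r → 3 ≤ vdeg G v) (hB : HasBook G)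
    (hsum : 4 * A.card - 2 ≤ ∑ v, vdeg G v) :
    ∃ a b, G.Adj a b ∧ a ≠ r ∧ b ≠ r ∧ HasBook (G \ edge a b) := by
  obtain ⟨u, v, x, y, z, h⟩ := hB
  have hx := (hG _ _ h.ux).2
  have hy := (hG _ _ h.uy).2
  have hz := (hG _ _ h.uz).2
  by_cases hru : r = u ∨ r = v
  · exact exists_edge_avoiding_of_spine h hru (hd x hx (by
      have h1 := h.ux.ne
      have h2 := h.vx.ne
      grind))
  by_cases hrz : r = z
  · subst hrz
    exact exists_edge_avoiding_of_page h (hd x hx h.xz) (hd y hy h.yz)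
  by_cases hrx : r = x
  · subst hrx
    exact exists_edge_avoiding_of_page h.rotate (hd y hy h.xy.symm) (hd z hz h.xz.symm)
  by_cases hry : r = y
  · subst hry
    exact exists_edge_avoiding_of_page h.rotate.rotate (hd z hz h.yz.symm) (hd x hx h.xy)
  by_contra hno
  -- A vertex outside the book and different from `r` has an edge that misses both `r` and the
  -- book's edges. So only six vertices remain to be considered.
  by_cases hA : ∃ q ∈ A, q ∉ ({u, v, x, y, z, r} : Finset V)
  · obtain ⟨q, hqA, hq⟩ := hA
    obtain ⟨t, ht, htr⟩ := exists_adj_not_mem (G := G) (v := q) (J := {r})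
      (lt_of_lt_of_le (by simp) (hd q hqA (by grind)))
    refine hno ⟨q, t, ht, by grind, by grind, u, v, x, y, z, h.sdiff_edge ?_⟩
    grind
  push Not at hA
  have h1 := h.uv.ne
  have h2 := h.ux.ne
  have h3 := h.uy.ne
  have h4 := h.uz.ne
  have h5 := h.vx.ne
  have h6 := h.vy.ne
  have h7 := h.vz.ne
  have h8 := h.xy
  have h9 := h.xz
  have h10 := h.yz
  have hu := (hG _ _ h.uv).1
  have hv := (hG _ _ h.uv).2
  have hAeq : A = {u, v, x, y, z, r} := by
    apply Finset.Subset.antisymm hA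
    intro q hq
    simp only [Finset.mem_insert, Finset.mem_singleton] at hq
    grind
  have key : ∀ s ∈ A, s ≠ r → (∀ t, G.Adj s t → t = u ∨ t = v ∨ t = r) →
      G.Adj r s ∧ vdeg G s ≤ 3 := by
    intro s hsA hsr hst
    refine ⟨?_, ?_⟩
    · obtain ⟨t, hst', ht⟩ := exists_adj_not_mem (G := G) (v := s) (J := {u, v})
        (Finset.card_le_two.trans_lt (hd s hsA hsr))
      have := hst t hst'
      have := hst'.symm
      grind
    · exact (vdeg_le_card (J := {u, v, r}) fun t ht => by simpa using hst t ht).trans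
        Finset.card_le_three
  have kx := key x hx (Ne.symm hrx) fun t ht => h.page_edge (Ne.symm hrx) hno ht
  have ky := key y hy (Ne.symm hry) fun t ht => h.rotate.page_edge (Ne.symm hry) hno ht
  have kz := key z hz (Ne.symm hrz) fun t ht => h.rotate.rotate.page_edge (Ne.symm hrz) hno ht
  have hru' : ¬ G.Adj r u := fun hu =>
    hno (exists_edge_avoiding_of_adj_spine h (by tauto) kx.1 ky.1 kz.1 hu)
  have hrv' : ¬ G.Adj r v := fun hv =>
    hno (exists_edge_avoiding_of_adj_spine h.swap (by tauto) kx.1 ky.1 kz.1 hv)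
  have du : vdeg G u ≤ 4 := (vdeg_le_card (J := {v, x, y, z}) fun t ht => by
    have h1 := hA t (hG _ _ ht).2
    have h2 := ht.ne
    have h3 := ht.symm
    simp only [Finset.mem_insert, Finset.mem_singleton] at h1 ⊢
    grind).trans Finset.card_le_four
  have dv : vdeg G v ≤ 4 := (vdeg_le_card (J := {u, x, y, z}) fun t ht => by
    have h1 := hA t (hG _ _ ht).2
    have h2 := ht.ne
    have h3 := ht.symm
    simp only [Finset.mem_insert, Finset.mem_singleton] at h1 ⊢
    grind).trans Finset.card_le_four
  have dr : vdeg G r ≤ 3 := (vdeg_le_card (J := {x, y, z}) fun t ht => by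
    have h1 := hA t (hG _ _ ht).2
    have h2 := ht.ne
    simp only [Finset.mem_insert, Finset.mem_singleton] at h1 ⊢
    grind).trans Finset.card_le_three
  have hcard : A.card = 6 := by
    rw [hAeq]
    repeat rw [Finset.card_insert_of_notMem (by simp; grind)]
    simp
  -- The spine contributes at most `4 + 4`, the pages and `r` at most 3 each: 20 in all, short of
  -- the required 22.
  rw [← sum_vdeg hG, hcard, hAeq] at hsum
  repeat rw [Finset.sum_insert (by simp; grind)] at hsum
  rw [Finset.sum_singleton] at hsum
  omega

/-! ### Switching around a cubic vertex -/

/-- `G'` has the degrees of `G` and stays inside `A`. -/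
def SameDegrees (A : Finset V) (G G' : SimpleGraph V) : Prop :=
  SupportedOn A G' ∧ ∀ v, vdeg G' v = vdeg G v

/-- If `x` is adjacent to both `q` and `r`, then `q r` is a spine with pages `w`, `p`, `x`.
Otherwise the edges `w p`, `x y` are exchanged for `w x`, `p y`: the neighbours of `w` become `x`,
`q`, `r`, and `x` misses one of the other two. -/
theorem hasBook_or_switch {G : SimpleGraph V} {A : Finset V} (hG : SupportedOn A G)
    {w p q r x y : V} (hN : ∀ t, G.Adj w t ↔ t = p ∨ t = q ∨ t = r) (hpq : G.Adj p q)
    (hpr : G.Adj p r) (hqr : G.Adj q r) (hxy : G.Adj x y) (hxw : x ≠ w) (hxp : x ≠ p)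
    (hxq : x ≠ q) (hxr : x ≠ r) (hyp : y ≠ p) (hpy : ¬ G.Adj p y) :
    HasBook G ∨ ∃ G', SameDegrees A G G' ∧ ∃ p q r, p ≠ q ∧ p ≠ r ∧ q ≠ r ∧
      (∀ t, G'.Adj w t ↔ t = p ∨ t = q ∨ t = r) ∧ ¬ G'.Adj p q := by
  have hwp : G.Adj w p := (hN p).2 (by simp)
  have hwq : G.Adj w q := (hN q).2 (by simp)
  have hwr : G.Adj w r := (hN r).2 (by simp)
  have hwx : ¬ G.Adj w x := by rw [hN]; tauto
  have hyw : y ≠ w := by rintro rfl; exact hwx hxy.symm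
  by_cases hb : G.Adj x q ∧ G.Adj x r
  · exact Or.inl ⟨q, r, w, p, x, hqr, hwq.symm, hpq.symm, hb.1.symm, hwr.symm, hpr.symm,
      hb.2.symm, hwp.ne, hxw.symm, hxp.symm⟩
  right
  have hc1 := G.adj_comm x y
  have hc2 := G.adj_comm p y
  have hc3 := G.adj_comm w x
  have e1 := hwp.ne
  have e2 := hwq.ne
  have e3 := hwr.ne
  have e4 := hpq.ne
  have e5 := hpr.ne
  have e6 := hqr.ne
  have e7 := hxy.ne
  have hxy1 : (G \ edge w p).Adj x y := by
    simp only [sdiff_adj, edge_adj]; tauto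
  have hwx1 : ¬ ((G \ edge w p) \ edge x y).Adj w x := by
    simp only [sdiff_adj, edge_adj]; tauto
  have hpy1 : ¬ (((G \ edge w p) \ edge x y) ⊔ edge w x).Adj p y := by
    simp only [sdiff_adj, edge_adj, sup_adj]; grind
  have hN' : ∀ t, ((((G \ edge w p) \ edge x y) ⊔ edge w x) ⊔ edge p y).Adj w t ↔
      t = x ∨ t = q ∨ t = r := by
    intro t
    simp only [sdiff_adj, edge_adj, sup_adj, hN]; grind
  have hxt : ∀ t, t = q ∨ t = r →
      ((((G \ edge w p) \ edge x y) ⊔ edge w x) ⊔ edge p y).Adj x t → G.Adj x t := by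
    intro t ht
    simp only [sdiff_adj, edge_adj, sup_adj]; grind
  have hsame : SameDegrees A G ((((G \ edge w p) \ edge x y) ⊔ edge w x) ⊔ edge p y) := by
    refine ⟨(((hG.sdiff _).sdiff _).sup_edge (hG _ _ hwp).1 (hG _ _ hxy).1).sup_edge
      (hG _ _ hwp).2 (hG _ _ hxy).2, fun v => ?_⟩
    rw [vdeg_sup_edge hyp.symm hpy1, vdeg_sup_edge hxw.symm hwx1]
    have h1 := vdeg_sdiff_edge hwp v
    have h2 := vdeg_sdiff_edge hxy1 v
    omega
  refine ⟨_, hsame, ?_⟩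
  by_cases hxq' : G.Adj x q
  · refine ⟨x, r, q, hxr, hxq, e6.symm, fun t => by rw [hN']; tauto, fun h => ?_⟩
    exact hb ⟨hxq', hxt r (Or.inr rfl) h⟩
  · exact ⟨x, q, r, hxq, hxr, e6, hN', fun h => hxq' (hxt q (Or.inl rfl) h)⟩

/-- Some realization has a book, or has two non-adjacent neighbours of the cubic vertex `w`. -/
theorem hasBook_or_nonadjacent_neighbors {G : SimpleGraph V} {A : Finset V}
    (hG : SupportedOn A G) (hA : 5 ≤ A.card) (hd : ∀ v ∈ A, 3 ≤ vdeg G v) {w : V}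
    (hw : vdeg G w = 3) :
    HasBook G ∨ ∃ G', SameDegrees A G G' ∧ ∃ p q r, p ≠ q ∧ p ≠ r ∧ q ≠ r ∧
      (∀ t, G'.Adj w t ↔ t = p ∨ t = q ∨ t = r) ∧ ¬ G'.Adj p q := by
  obtain ⟨J, hJ, hJc⟩ := exists_neighbors G w
  obtain ⟨p, q, r, e1, e2, e3, rfl⟩ := Finset.card_eq_three.1 (hJc.trans hw)
  have hN : ∀ t, G.Adj w t ↔ t = p ∨ t = q ∨ t = r := fun t => by simp [← hJ]
  have hself : SameDegrees A G G := ⟨hG, fun _ => rfl⟩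
  by_cases hpq : G.Adj p q
  swap
  · exact Or.inr ⟨G, hself, p, q, r, e1, e2, e3, hN, hpq⟩
  by_cases hpr : G.Adj p r
  swap
  · exact Or.inr ⟨G, hself, p, r, q, e2, e1, e3.symm, fun t => by rw [hN]; tauto, hpr⟩
  by_cases hqr : G.Adj q r
  swap
  · exact Or.inr ⟨G, hself, q, r, p, e3, e1.symm, e2.symm, fun t => by rw [hN]; tauto, hqr⟩
  have hwp : G.Adj w p := (hN p).2 (by simp)
  have hwq : G.Adj w q := (hN q).2 (by simp)
  have hwr : G.Adj w r := (hN r).2 (by simp)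
  obtain ⟨x, hxA, hx⟩ : ∃ x ∈ A, x ∉ ({w, p, q, r} : Finset V) :=
    Finset.exists_mem_notMem_of_card_lt_card (Finset.card_le_four.trans_lt hA)
  simp only [Finset.mem_insert, Finset.mem_singleton, not_or] at hx
  obtain ⟨hxw, hxp, hxq, hxr⟩ := hx
  by_cases h1 : ∃ y, G.Adj x y ∧ y ≠ p ∧ ¬ G.Adj p y
  · obtain ⟨y, hxy, hy, hy'⟩ := h1
    exact hasBook_or_switch hG hN hpq hpr hqr hxy hxw hxp hxq hxr hy hy'
  by_cases h2 : ∃ y, G.Adj x y ∧ y ≠ q ∧ ¬ G.Adj q y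
  · obtain ⟨y, hxy, hy, hy'⟩ := h2
    exact hasBook_or_switch hG (fun t => by rw [hN]; tauto) hpq.symm hqr hpr hxy hxw hxq hxp hxr
      hy hy'
  by_cases h3 : ∃ y, G.Adj x y ∧ y ≠ r ∧ ¬ G.Adj r y
  · obtain ⟨y, hxy, hy, hy'⟩ := h3
    exact hasBook_or_switch hG (fun t => by rw [hN]; tauto) hqr.symm hpr.symm hpq.symm hxy hxw
      hxr hxq hxp hy hy'
  -- No switch is available: each neighbour of `x` equals or is adjacent to each of `p`, `q`, `r`.
  -- Either such a neighbour outside the triangle, or `x` itself, is then a third page on the spine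
  -- `p q`, beside `w` and `r`.
  push Not at h1 h2 h3
  left
  by_cases hy : ∃ y, G.Adj x y ∧ y ∉ ({p, q, r} : Finset V)
  · obtain ⟨y, hxy, hy⟩ := hy
    simp only [Finset.mem_insert, Finset.mem_singleton, not_or] at hy
    refine ⟨p, q, w, r, y, hpq, hwp.symm, hpr, h1 y hxy hy.1, hwq.symm, hqr, h2 y hxy hy.2.1,
      hwr.ne, ?_, fun h => hy.2.2 h.symm⟩
    rintro rfl
    have := (hN x).1 hxy.symm
    tauto
  · push Not at hy
    have hall : ∀ t ∈ ({p, q, r} : Finset V), G.Adj x t := fun t ht =>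
      adj_of_vdeg_eq hy (Finset.card_le_three.trans (hd x hxA)) ht
    exact ⟨p, q, w, r, x, hpq, hwp.symm, hpr, (hall p (by simp)).symm, hwq.symm, hqr,
      (hall q (by simp)).symm, hwr.ne, Ne.symm hxw, Ne.symm hxr⟩

end

/-! ### Constructions of prescribed degree sequences -/

section
variable {V : Type*} [Fintype V] [DecidableEq V]

theorem SupportedOn.not_adj {G : SimpleGraph V} {A : Finset V} (hG : SupportedOn A G) {w : V}
    (hw : w ∉ A) (x : V) : ¬ G.Adj w x := fun h => hw (hG _ _ h).1

/-- Subdividing the edge `a b` by a new vertex `w` and joining `w` to `r`. -/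
theorem vdeg_subdivide {G : SimpleGraph V} {A : Finset V} (hG : SupportedOn A G) {w a b r : V}
    (hw : w ∉ A) (hab : G.Adj a b) (hr : r ∈ A) (har : a ≠ r) (hbr : b ≠ r) (v : V) :
    vdeg ((G \ edge a b) ⊔ starAt w {a, b, r}) v =
      vdeg G v + if v = w then 3 else if v = r then 1 else 0 := by
  have ha := (hG _ _ hab).1
  have hb := (hG _ _ hab).2
  have hne := hab.ne
  rw [vdeg_sup_star (by grind) ((hG.sdiff _).not_adj hw), Finset.card_eq_three.2
    ⟨a, b, r, hne, har, hbr, rfl⟩]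
  have := vdeg_sdiff_edge hab v
  simp only [Finset.mem_insert, Finset.mem_singleton]
  grind

theorem SupportedOn.subdivide {G : SimpleGraph V} {A : Finset V} (hG : SupportedOn A G)
    {w a b r : V} (hab : G.Adj a b) (hr : r ∈ A) :
    SupportedOn (insert w A) ((G \ edge a b) ⊔ starAt w {a, b, r}) := by
  have ha := (hG _ _ hab).1
  have hb := (hG _ _ hab).2
  exact (hG.sdiff _).sup_star (by grind)

/-- The complete graph on `A`. -/
def completeOn (A : Finset V) : SimpleGraph V where
  Adj x y := x ≠ y ∧ x ∈ A ∧ y ∈ A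
  symm := ⟨fun _ _ h => ⟨h.1.symm, h.2.2, h.2.1⟩⟩
  loopless := ⟨fun _ h => h.1 rfl⟩

theorem supportedOn_completeOn (A : Finset V) : SupportedOn A (completeOn A) :=
  fun _ _ h => h.2

theorem vdeg_completeOn {A : Finset V} {v : V} (hv : v ∈ A) :
    vdeg (completeOn A) v = A.card - 1 := by
  rw [← Finset.card_erase_of_mem hv]
  apply le_antisymm
  · exact vdeg_le_card fun x hx => Finset.mem_erase.2 ⟨hx.1.symm, hx.2.2⟩
  · exact card_le_vdeg fun x hx =>
      ⟨(Finset.mem_erase.1 hx).1.symm, hv, (Finset.mem_erase.1 hx).2⟩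

/-- Every vertex set of size at least four carries a wheel with prescribed hub. -/
theorem exists_wheel (n : ℕ) (hn : 4 ≤ n) : ∀ A : Finset V, A.card = n → ∀ h ∈ A,
    ∃ G : SimpleGraph V, SupportedOn A G ∧ vdeg G h = n - 1 ∧
      ∀ v ∈ A, v ≠ h → vdeg G v = 3 := by
  induction n, hn using Nat.le_induction with
  | base =>
    intro A hA h hh
    exact ⟨completeOn A, supportedOn_completeOn A, by rw [vdeg_completeOn hh, hA],
      fun v hv _ => by rw [vdeg_completeOn hv, hA]⟩
  | succ n hn ih =>
    intro A hA h hh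
    obtain ⟨w, hwA, hwh⟩ := Finset.exists_mem_ne (s := A) (by omega) h
    have hh' : h ∈ A.erase w := Finset.mem_erase.2 ⟨hwh.symm, hh⟩
    have hc : (A.erase w).card = n := by rw [Finset.card_erase_of_mem hwA]; omega
    obtain ⟨G, hG, hGh, hGd⟩ := ih _ hc h hh'
    -- Subdividing an edge off the hub and joining the new vertex to the hub enlarges the wheel.
    obtain ⟨a, haA, hah⟩ := Finset.exists_mem_ne (s := A.erase w) (by omega) h
    obtain ⟨b, hab, hb⟩ := exists_adj_not_mem (G := G) (v := a) (J := {h})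
      (by rw [hGd a haA hah]; simp)
    have hbh : b ≠ h := by simpa using hb
    refine ⟨_, Finset.insert_erase hwA ▸ hG.subdivide hab hh', ?_, fun v hv hvh => ?_⟩
    · rw [vdeg_subdivide hG (by simp) hab hh' hah hbh, if_neg hwh.symm, if_pos rfl, hGh]
      omega
    · rw [vdeg_subdivide hG (by simp) hab hh' hah hbh]
      by_cases hvw : v = w
      · rw [if_pos hvw, vdeg_eq_zero hG (by simp [hvw])]
      · rw [if_neg hvw, if_neg hvh, hGd v (Finset.mem_erase.2 ⟨hvw, hv⟩) hvh]

theorem vdeg_map {W : Type*} (G : SimpleGraph W) (f : W ↪ V) (v : W) :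
    vdeg (G.map f) (f v) = vdeg G v := by
  rw [vdeg, vdeg, ← Set.ncard_image_of_injective _ f.injective]
  congr 1
  ext x
  simp only [mem_neighborSet, map_adj, Set.mem_image]
  constructor
  · rintro ⟨a, b, h, ha, rfl⟩
    exact ⟨b, f.injective ha ▸ h, rfl⟩
  · rintro ⟨b, h, rfl⟩
    exact ⟨v, b, h, rfl, rfl⟩

/-- The 4-regular graph on seven vertices consisting of the edges `01`, `23` and all edges
between `{0, 1, 2, 3}` and `{4, 5, 6}`. -/
def regularSeven : SimpleGraph (Fin 7) where
  Adj i j := i / 2 = j / 2 ∧ i ≠ j ∧ i < 4 ∧ j < 4 ∨ i < 4 ∧ 4 ≤ j ∨ j < 4 ∧ 4 ≤ i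
  symm := ⟨by decide⟩
  loopless := ⟨by decide⟩

instance : DecidableRel regularSeven.Adj := fun _ _ => inferInstanceAs (Decidable (_ ∨ _))

theorem vdeg_regularSeven (i : Fin 7) : vdeg regularSeven i = 4 := by
  have : vdeg regularSeven i = (Finset.univ.filter (regularSeven.Adj i)).card :=
    le_antisymm (vdeg_le_card fun x hx => by simpa using hx)
      (card_le_vdeg fun x hx => by simpa using hx)
  rw [this]
  clear this
  revert i
  decide

/-- Every vertex set of size at least seven carries a 4-regular graph with a book. -/
theorem exists_regular_hasBook (n : ℕ) (hn : 7 ≤ n) : ∀ A : Finset V, A.card = n →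
    ∃ G : SimpleGraph V, SupportedOn A G ∧ HasBook G ∧ ∀ v ∈ A, vdeg G v = 4 := by
  induction n, hn using Nat.le_induction with
  | base =>
    intro A hA
    let e := (A.equivFinOfCardEq hA).symm
    let f : Fin 7 ↪ V := e.toEmbedding.trans (Function.Embedding.subtype _)
    have hf : ∀ i, f i ∈ A := fun i => (e i).2
    refine ⟨regularSeven.map f, ?_, ⟨f 0, f 1, f 4, f 5, f 6, ?_⟩, ?_⟩
    · rintro x y ⟨-, a, b, -, rfl, rfl⟩
      exact ⟨hf a, hf b⟩
    · have hadj : ∀ i j, regularSeven.Adj i j → (regularSeven.map f).Adj (f i) (f j) :=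
        fun i j h => (map_adj_apply).2 h
      constructor <;>
        first
        | exact hadj _ _ (by decide)
        | exact f.injective.ne (by decide)
    · intro v hv
      have : v = f (e.symm ⟨v, hv⟩) := by simp [f]
      rw [this, vdeg_map, vdeg_regularSeven]
  | succ n hn ih =>
    intro A hA
    obtain ⟨w, hw⟩ : A.Nonempty := Finset.card_pos.1 (by omega)
    have hc : (A.erase w).card = n := by rw [Finset.card_erase_of_mem hw]; omega
    obtain ⟨G, hG, ⟨u, v, x, y, z, hB⟩, hd⟩ := ih _ hc
    -- At least seven vertices minus at most five in the book leave two. Each has an edge outside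
    -- the book, and these are chosen disjoint; replacing them by edges from `w` to their four ends
    -- keeps regularity.
    have hcard : 1 < ((A.erase w) \ {u, v, x, y, z}).card := by
      have := Finset.le_card_sdiff {u, v, x, y, z} (A.erase w)
      have : ({u, v, x, y, z} : Finset V).card ≤ 5 := Finset.card_le_five
      omega
    obtain ⟨a, ha, c, hc, hac⟩ := Finset.one_lt_card.1 hcard
    rw [Finset.mem_sdiff] at ha hc
    obtain ⟨b, hab, hb⟩ := exists_adj_not_mem (G := G) (v := a) (J := {c})
      (by rw [hd a ha.1]; simp)
    obtain ⟨d, hcd, hdn⟩ := exists_adj_not_mem (G := G) (v := c) (J := {a, b})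
      (by rw [hd c hc.1]; exact Finset.card_le_two.trans_lt (by norm_num))
    simp only [Finset.mem_insert, Finset.mem_singleton, not_or] at ha hb hc hdn
    have hcd' : (G \ edge a b).Adj c d := by
      simp only [sdiff_adj, edge_adj]
      tauto
    have hbA := (hG _ _ hab).2
    have hdA := (hG _ _ hcd).2
    have e1 := hab.ne
    have e2 := hcd.ne
    have hJ : ({a, b, c, d} : Finset V).card = 4 := by
      repeat rw [Finset.card_insert_of_notMem (by simp; grind)]
      simp
    clear ih hcard
    refine ⟨((G \ edge a b) \ edge c d) ⊔ starAt w {a, b, c, d}, ?_, ?_, ?_⟩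
    · exact Finset.insert_erase hw ▸ ((hG.sdiff _).sdiff _).sup_star (by
        simp only [Finset.insert_subset_iff, Finset.singleton_subset_iff]
        exact ⟨ha.1, hbA, hc.1, hdA⟩)
    · have h1 : IsBook (G \ edge a b) u v x y z := hB.sdiff_edge (by grind)
      have h2 : IsBook ((G \ edge a b) \ edge c d) u v x y z := h1.sdiff_edge (by grind)
      exact ⟨u, v, x, y, z, h2.mono le_sup_left⟩
    · intro t ht
      have hwn : w ∉ ({a, b, c, d} : Finset V) := by
        simp only [Finset.mem_erase] at ha hc hbA hdA
        simp only [Finset.mem_insert, Finset.mem_singleton]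
        grind
      rw [vdeg_sup_star hwn (((hG.sdiff _).sdiff _).not_adj (by simp)), hJ]
      have h1 := vdeg_sdiff_edge hab t
      have h2 := vdeg_sdiff_edge hcd' t
      simp only [Finset.mem_insert, Finset.mem_singleton]
      by_cases htw : t = w
      · have := vdeg_eq_zero hG (v := t) (by simp [htw])
        grind
      · have := hd t (Finset.mem_erase.2 ⟨htw, ht⟩)
        grind

/-- A vertex joined to a proper nonempty part of a 4-regular graph on six vertices: the degree
sequence has a realization with a book. -/
theorem exists_hasBook_of_six {A J : Finset V} (hA : A.card = 6) {w : V} (hw : w ∉ A)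
    (hJ : J ⊆ A) (hJ1 : 1 ≤ J.card) (hJ5 : J.card ≤ 5) :
    ∃ G : SimpleGraph V, SupportedOn (insert w A) G ∧ HasBook G ∧ vdeg G w = J.card ∧
      ∀ v ∈ A, vdeg G v = 4 + if v ∈ J then 1 else 0 := by
  -- Removing `p a`, `p b`, `c d` from the complete graph on `A` leaves degree 5 at `f`, 3 at `p`
  -- and 4 elsewhere. Joining `w` to `J` with `f` exchanged for `p` then gives the required degrees.
  obtain ⟨f, hf⟩ := Finset.card_pos.1 hJ1
  obtain ⟨p, hp, hpJ⟩ : ∃ p ∈ A, p ∉ J :=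
    Finset.exists_mem_notMem_of_card_lt_card (by omega)
  have hfA := hJ hf
  have hfp : f ≠ p := by rintro rfl; exact hpJ hf
  have hp' : p ∈ A.erase f := Finset.mem_erase.2 ⟨hfp.symm, hp⟩
  have h4 : ((A.erase f).erase p).card = 3 + 1 := by
    rw [Finset.card_erase_of_mem hp', Finset.card_erase_of_mem hfA, hA]
  obtain ⟨d, T, hdT, hT, hT3⟩ := Finset.card_eq_succ.1 h4
  obtain ⟨a, b, c, hab, hac, hbc, rfl⟩ := Finset.card_eq_three.1 hT3
  have hmem : ∀ v, v ∈ A ↔ v = f ∨ v = p ∨ v = a ∨ v = b ∨ v = c ∨ v = d := by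
    intro v
    have := Finset.ext_iff.1 hT v
    simp only [Finset.mem_insert, Finset.mem_singleton, Finset.mem_erase] at this
    grind
  have hmem' : ∀ v, v ∈ ({d, a, b, c} : Finset V) → v ≠ f ∧ v ≠ p := by
    intro v hv
    rw [hT] at hv
    simp only [Finset.mem_erase] at hv
    tauto
  have hd := hmem' d (by simp)
  have ha := hmem' a (by simp)
  have hb := hmem' b (by simp)
  have hc := hmem' c (by simp)
  simp only [Finset.mem_insert, Finset.mem_singleton, not_or] at hdT
  have mf := (hmem f).2 (by tauto)
  have mp := (hmem p).2 (by tauto)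
  have ma := (hmem a).2 (by tauto)
  have mb := (hmem b).2 (by tauto)
  have mc := (hmem c).2 (by tauto)
  have md := (hmem d).2 (by tauto)
  have a1 : (completeOn A).Adj p a := ⟨by tauto, mp, ma⟩
  have a2 : (completeOn A \ edge p a).Adj p b := by
    simp only [sdiff_adj, edge_adj, completeOn]; tauto
  have a3 : ((completeOn A \ edge p a) \ edge p b).Adj c d := by
    simp only [sdiff_adj, edge_adj, completeOn]; grind
  have hR : SupportedOn A (((completeOn A \ edge p a) \ edge p b) \ edge c d) :=
    (((supportedOn_completeOn A).sdiff _).sdiff _).sdiff _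
  have hKA : insert p (J.erase f) ⊆ A := by
    intro v hv
    have := @hJ v
    grind
  have hKc : (insert p (J.erase f)).card = J.card := by
    rw [Finset.card_insert_of_notMem (by simp [hpJ]), Finset.card_erase_of_mem hf]
    omega
  have hdeg := fun v => vdeg_sup_star (fun h => hw (hKA h)) (hR.not_adj hw) v
  rw [hKc] at hdeg
  refine ⟨_, hR.sup_star hKA, HasBook.mono ⟨f, c, p, a, b, ?_⟩ le_sup_left, ?_, ?_⟩
  · constructor <;>
      first
      | (simp only [sdiff_adj, edge_adj, completeOn]; grind)
      | tauto
  · rw [hdeg, if_pos rfl, vdeg_eq_zero hR hw, zero_add]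
  · intro v hv
    rw [hdeg, if_neg (by rintro rfl; exact hw hv)]
    have h1 := vdeg_sdiff_edge a1 v
    have h2 := vdeg_sdiff_edge a2 v
    have h3 := vdeg_sdiff_edge a3 v
    rw [vdeg_completeOn hv, hA] at h1
    simp only [Finset.mem_insert, Finset.mem_erase]
    rcases (hmem v).1 hv with rfl | rfl | rfl | rfl | rfl | rfl <;> grind

end

/-! ### The induction on the order -/

section
variable {V : Type*} [Fintype V] [DecidableEq V]

theorem hasBook_of_card_five {A : Finset V} (hA : A.card = 5) {G : SimpleGraph V}
    (hG : SupportedOn A G) (hsum : 18 ≤ ∑ v, vdeg G v) : HasBook G := by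
  rw [← sum_vdeg hG] at hsum
  have hle : ∀ v ∈ A, vdeg G v ≤ 4 := fun v hv => by
    have : (A.erase v).card = 4 := by rw [Finset.card_erase_of_mem hv, hA]
    exact this ▸ vdeg_le_card fun x hx => Finset.mem_erase.2 ⟨hx.ne.symm, (hG _ _ hx).2⟩
  have hall : ∀ v ∈ A, vdeg G v = 4 → ∀ x ∈ A, x ≠ v → G.Adj v x := fun v hv h4 x hx hxv =>
    adj_of_vdeg_eq (J := A.erase v)
      (fun x hx => Finset.mem_erase.2 ⟨hx.ne.symm, (hG _ _ hx).2⟩)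
      (by rw [Finset.card_erase_of_mem hv, hA, h4]) (Finset.mem_erase.2 ⟨hxv, hx⟩)
  obtain ⟨u, hu, v, hv, huv⟩ : ∃ u ∈ A.filter (vdeg G · = 4), ∃ v ∈ A.filter (vdeg G · = 4),
      u ≠ v := by
    rw [← Finset.one_lt_card]
    -- With five degrees at most 4, the sum is at most 15 plus the number of vertices of degree 4.
    have h1 : ∑ v ∈ A, vdeg G v ≤ ∑ v ∈ A, (3 + if vdeg G v = 4 then 1 else 0) :=
      Finset.sum_le_sum fun v hv => by have := hle v hv; grind
    rw [Finset.sum_add_distrib, Finset.sum_boole] at h1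
    simp [hA] at h1
    omega
  rw [Finset.mem_filter] at hu hv
  have hv' : v ∈ A.erase u := Finset.mem_erase.2 ⟨huv.symm, hv.1⟩
  have h3 : ((A.erase u).erase v).card = 3 := by
    rw [Finset.card_erase_of_mem hv', Finset.card_erase_of_mem hu.1, hA]
  obtain ⟨x, y, z, hxy, hxz, hyz, hT⟩ := Finset.card_eq_three.1 h3
  have key : ∀ t ∈ ({x, y, z} : Finset V), G.Adj u t ∧ G.Adj v t := by
    intro t ht
    rw [← hT] at ht
    simp only [Finset.mem_erase] at ht
    exact ⟨hall u hu.1 hu.2 t ht.2.2 ht.2.1, hall v hv.1 hv.2 t ht.2.2 ht.1⟩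
  have hx := key x (by simp)
  have hy := key y (by simp)
  have hz := key z (by simp)
  exact ⟨u, v, x, y, z, hall u hu.1 hu.2 v hv.1 huv.symm, hx.1, hy.1, hz.1, hx.2, hy.2, hz.2,
    hxy, hxz, hyz⟩

/-- The conclusion of the main result for all graphs on `n` vertices. -/
def BookRealizable (V : Type*) [Fintype V] [DecidableEq V] (n : ℕ) : Prop :=
  ∀ A : Finset V, A.card = n → ∀ G : SimpleGraph V, SupportedOn A G →
    4 * n - 2 ≤ ∑ v, vdeg G v →
    (n = 6 ∧ ∀ v ∈ A, vdeg G v = 4) ∨ ∃ G', SameDegrees A G G' ∧ HasBook G'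

/-- Induction step deleting a vertex. -/
theorem exists_hasBook_of_isolate {n : ℕ} (hn : 5 ≤ n) (ih : BookRealizable V n) {A : Finset V}
    (hA : A.card = n + 1) {G : SimpleGraph V} (hG : SupportedOn A G) {w : V} (hw : w ∈ A)
    (hmin : ∀ v ∈ A, vdeg G w ≤ vdeg G v) (hsum : 4 * (n + 1) - 2 ≤ ∑ v, vdeg G v)
    (hsum' : 4 * n - 2 + 2 * vdeg G w ≤ ∑ v, vdeg G v) :
    ∃ G', SameDegrees A G G' ∧ HasBook G' := by
  obtain ⟨J, hJ, hJc⟩ := exists_neighbors G w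
  have hc : (A.erase w).card = n := by rw [Finset.card_erase_of_mem hw]; omega
  have hIs := sum_vdeg_isolate hJ
  have hI := vdeg_isolate hJ
  have hwJ : w ∉ J := by simp [hJ]
  have hJA : J ⊆ A.erase w := fun x hx =>
    Finset.mem_erase.2 ⟨fun h => hwJ (h ▸ hx), (hG _ _ ((hJ x).1 hx)).2⟩
  have hIG := hG.isolate w
  rcases ih _ hc _ hIG (by omega) with ⟨rfl, h4⟩ | ⟨D, ⟨hD, hDd⟩, hB⟩
  · rw [← sum_vdeg hIG, Finset.sum_congr rfl h4, Finset.sum_const, hc] at hIs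
    -- The sum is `24 + 2d`, where `d` is the degree of `w`. It is at least 26, so `1 ≤ d`; by
    -- minimality it is at least `7d`, so `d ≤ 4`.
    have hmul : A.card • vdeg G w ≤ ∑ v ∈ A, vdeg G v := Finset.card_nsmul_le_sum _ _ _ hmin
    rw [sum_vdeg hG, hA] at hmul
    simp only [smul_eq_mul] at hmul hIs
    obtain ⟨K, hK, hB, hKw, hKd⟩ := exists_hasBook_of_six hc (Finset.notMem_erase w A) hJA
      (by omega) (by omega)
    rw [Finset.insert_erase hw] at hK
    refine ⟨K, ⟨hK, fun v => ?_⟩, hB⟩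
    by_cases hvA : v ∈ A
    · by_cases hvw : v = w
      · rw [hvw, hKw, hJc]
      · have hv : v ∈ A.erase w := Finset.mem_erase.2 ⟨hvw, hvA⟩
        rw [hKd v hv, ← hI v, if_neg hvw, h4 v hv]
    · rw [vdeg_eq_zero hK hvA, vdeg_eq_zero hG hvA]
  · refine ⟨D ⊔ starAt w J, ⟨Finset.insert_erase hw ▸ hD.sup_star hJA, fun v => ?_⟩,
      hB.mono le_sup_left⟩
    rw [vdeg_sup_star hwJ (hD.not_adj (Finset.notMem_erase w A)), hDd, hI]

/-- Induction step suppressing a cubic vertex. -/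
theorem exists_hasBook_of_cubic {n : ℕ} (hn : 5 ≤ n) (ih : BookRealizable V n) {A : Finset V}
    (hA : A.card = n + 1) {G : SimpleGraph V} (hG : SupportedOn A G) {w : V} (hw : w ∈ A)
    (hmin : ∀ v ∈ A, 3 ≤ vdeg G v) (hw3 : vdeg G w = 3)
    (hsum : 4 * (n + 1) - 2 ≤ ∑ v, vdeg G v) (hlt : ∑ v, vdeg G v < 4 * (n + 1)) :
    ∃ G', SameDegrees A G G' ∧ HasBook G' := by
  rcases hasBook_or_nonadjacent_neighbors hG (by omega) hmin hw3 with
    hB | ⟨G₁, ⟨hG₁, hd₁⟩, p, q, r, hpq, hpr, hqr, hN, hna⟩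
  · exact ⟨G, ⟨hG, fun _ => rfl⟩, hB⟩
  have hc : (A.erase w).card = n := by rw [Finset.card_erase_of_mem hw]; omega
  have hJ : ∀ x, x ∈ ({p, q, r} : Finset V) ↔ G₁.Adj w x := fun x => by simp [hN]
  have hJc : ({p, q, r} : Finset V).card = 3 := Finset.card_eq_three.2 ⟨p, q, r, hpq, hpr, hqr, rfl⟩
  have hIs := sum_vdeg_isolate hJ
  have hI := vdeg_isolate hJ
  have hsum₁ : ∑ v, vdeg G₁ v = ∑ v, vdeg G v := Finset.sum_congr rfl fun v _ => hd₁ v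
  rw [hJc] at hIs
  have hnp : ∀ t, t = p ∨ t = q ∨ t = r → t ∈ A.erase w := fun t ht => by
    have := (hN t).2 ht
    exact Finset.mem_erase.2 ⟨this.ne.symm, (hG₁ _ _ this).2⟩
  have hDd := vdeg_sup_edge hpq (fun h => hna h.1 : ¬ (isolate G₁ w).Adj p q)
  have hDG := (hG₁.isolate w).sup_edge (hnp p (by tauto)) (hnp q (by tauto))
  have hDs : ∑ v, vdeg (isolate G₁ w ⊔ edge p q) v = ∑ v, vdeg (isolate G₁ w) v + 1 + 1 := by
    rw [Finset.sum_congr rfl fun v _ => hDd v, Finset.sum_add_distrib, Finset.sum_add_distrib,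
      Finset.sum_ite_eq', Finset.sum_ite_eq']
    simp
  have hdeg : ∀ v, v ≠ w →
      vdeg (isolate G₁ w ⊔ edge p q) v + (if v = r then 1 else 0) = vdeg G v := by
    intro v hv
    have h1 := hI v
    rw [if_neg hv, hd₁] at h1
    rw [hDd, ← h1]
    simp only [Finset.mem_insert, Finset.mem_singleton]
    grind
  rcases ih _ hc _ hDG (by omega) with ⟨rfl, h4⟩ | ⟨D, ⟨hD, hDe⟩, hB⟩
  -- The exception would need degree sum 24, but the sum after suppression is below `4n = 24`.
  · rw [← sum_vdeg hDG, Finset.sum_congr rfl h4, Finset.sum_const, hc, smul_eq_mul] at hDs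
    omega
  -- Only `r` lost a degree in the suppression, so it alone may fall below three.
  obtain ⟨a, b, hab, har, hbr, hB'⟩ := exists_edge_avoiding hD (hnp r (by tauto))
    (fun v hv hvr => by
      have := hdeg v (Finset.mem_erase.1 hv).1
      rw [if_neg hvr] at this
      rw [hDe, ← Nat.add_zero (vdeg _ v), this]
      exact hmin v (Finset.mem_erase.1 hv).2) hB
    (by
      have : ∑ v, vdeg D v = ∑ v, vdeg (isolate G₁ w ⊔ edge p q) v :=
        Finset.sum_congr rfl fun v _ => hDe v
      omega)
  refine ⟨_, ⟨Finset.insert_erase hw ▸ hD.subdivide hab (hnp r (by tauto)), fun v => ?_⟩,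
    hB'.mono le_sup_left⟩
  rw [vdeg_subdivide hD (Finset.notMem_erase w A) hab (hnp r (by tauto)) har hbr]
  by_cases hv : v = w
  · rw [if_pos hv, hv, vdeg_eq_zero hD (Finset.notMem_erase w A), hw3]
  · rw [if_neg hv, hDe, hdeg v hv]

/-- A graph on `n ≥ 5` vertices with degree sum at least `4 n - 2` has the degrees of a graph
with a book, unless it is 4-regular on six vertices. -/
theorem bookRealizable (n : ℕ) (hn : 5 ≤ n) : BookRealizable V n := by
  induction n, hn using Nat.le_induction with
  | base =>
    intro A hA G hG hsum
    exact Or.inr ⟨G, ⟨hG, fun _ => rfl⟩, hasBook_of_card_five hA hG hsum⟩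
  | succ n hn ih =>
    intro A hA G hG hsum
    obtain ⟨w, hw, hmin⟩ := Finset.exists_min_image A (vdeg G) (Finset.card_pos.1 (by omega))
    by_cases hdel : 4 * n - 2 + 2 * vdeg G w ≤ ∑ v, vdeg G v
    · exact Or.inr (exists_hasBook_of_isolate hn ih hA hG hw hmin hsum hdel)
    have hmul : A.card • vdeg G w ≤ ∑ v ∈ A, vdeg G v := Finset.card_nsmul_le_sum _ _ _ hmin
    rw [sum_vdeg hG, hA, smul_eq_mul] at hmul
    have h3 : 3 ≤ vdeg G w := by omega
    have h4 : vdeg G w ≤ 4 := by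
      by_contra! h5
      have hlt : ∑ v, vdeg G v + 2 < 4 * n + 2 * vdeg G w := by omega
      -- Minimality and failed deletion give `(n - 1)d < 4n - 2`, impossible for `d ≥ 5` and `n ≥
      -- 5`.
      nlinarith [Nat.mul_le_mul (Nat.sub_le_sub_right hn 1) h5, Nat.mul_le_mul hn h5,
        mul_nonneg (Nat.zero_le (n - 5)) (Nat.zero_le (vdeg G w - 5))]
    obtain h3 | h4 : vdeg G w = 3 ∨ vdeg G w = 4 := by omega
    · exact Or.inr (exists_hasBook_of_cubic hn ih hA hG hw (fun v hv => h3 ▸ hmin v hv) h3 hsum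
        (by omega))
    -- The sum is even, at least `4n + 4` and below `4n + 6`, so every degree equals the minimum 4.
    · obtain ⟨k, hk⟩ := even_sum_vdeg G
      have hreg : ∀ v ∈ A, vdeg G v = 4 := by
        rw [h4] at hmin hmul hdel
        have heq : ∑ v ∈ A, 4 = ∑ v ∈ A, vdeg G v := by
          rw [sum_vdeg hG, Finset.sum_const, hA, smul_eq_mul]
          omega
        exact fun v hv => ((Finset.sum_eq_sum_iff_of_le hmin).1 heq v hv).symm
      by_cases h6 : n = 5
      · exact Or.inl ⟨by omega, hreg⟩
      · obtain ⟨K, hK, hB, hKd⟩ := exists_regular_hasBook (n + 1) (by omega) A hA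
        refine Or.inr ⟨K, ⟨hK, fun v => ?_⟩, hB⟩
        by_cases hv : v ∈ A
        · rw [hKd v hv, hreg v hv]
        · rw [vdeg_eq_zero hK hv, vdeg_eq_zero hG hv]

end

/-! ### Degree sequences and sharpness -/

theorem isPotentially_or_of_sum_le {n : ℕ} (hn : 5 ≤ n) {S : Fin n → ℕ} (hS : IsGraphical S)
    (hsum : 4 * n - 2 ≤ ∑ i, S i) : IsPotentially (Kp11 3) S ∨ (n = 6 ∧ ∀ i, S i = 4) := by
  obtain ⟨G, hG⟩ := hS
  have hdeg : ∀ i, vdeg G i = S i := hG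
  rcases bookRealizable n hn Finset.univ (by simp) G (fun _ _ _ => by simp)
    (by rwa [Finset.sum_congr rfl fun i _ => hdeg i]) with ⟨h6, h4⟩ | ⟨G', ⟨-, hd⟩, hB⟩
  · exact Or.inr ⟨h6, fun i => by rw [← hdeg, h4 i (Finset.mem_univ i)]⟩
  · exact Or.inl ⟨G', fun i => (hd i).trans (hdeg i), isContained_iff_hasBook.2 hB⟩

/-- The degree sequence of a wheel is graphical but not potentially `K_{3,1,1}`-graphical. -/
theorem exists_wheel_sequence {n : ℕ} (hn : 5 ≤ n) : ∃ S : Fin n → ℕ, IsGraphical S ∧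
    ∑ i, S i = 4 * n - 4 ∧ ¬ IsPotentially (Kp11 3) S := by
  obtain ⟨m, rfl⟩ : ∃ m, n = m + 1 := ⟨n - 1, by omega⟩
  obtain ⟨G, -, h0, hG⟩ := exists_wheel (m + 1) (by omega) (Finset.univ : Finset (Fin (m + 1)))
    (by simp) 0 (Finset.mem_univ _)
  refine ⟨vdeg G, ⟨G, fun _ => rfl⟩, ?_, ?_⟩
  · rw [Fin.sum_univ_succ, h0, Finset.sum_congr rfl fun i _ =>
      hG (Fin.succ i) (Finset.mem_univ _) (Fin.succ_ne_zero i)]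
    simp
    omega
  · rintro ⟨K, hK, hc⟩
    obtain ⟨u, v, x, y, z, h⟩ := isContained_iff_hasBook.1 hc
    have hKd : ∀ i, vdeg K i = vdeg G i := hK
    -- A spine end has four neighbours, so it must be the hub; both ends cannot be.
    have key : ∀ s t, K.Adj s t → K.Adj s x → K.Adj s y → K.Adj s z → K.Adj t x → K.Adj t y →
        K.Adj t z → s = 0 := by
      intro s t h1 h2 h3 h4 h5 h6 h7
      by_contra hs
      have h8 : ({t, x, y, z} : Finset _).card ≤ vdeg K s := card_le_vdeg (by
        simp only [Finset.mem_insert, Finset.mem_singleton]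
        rintro a (rfl | rfl | rfl | rfl) <;> assumption)
      rw [hKd, hG s (Finset.mem_univ s) hs, Finset.card_insert_of_notMem (by
        simp [h5.ne, h6.ne, h7.ne]), Finset.card_eq_three.2 ⟨x, y, z, h.xy, h.xz, h.yz, rfl⟩] at h8
      omega
    exact h.uv.ne ((key u v h.uv h.ux h.uy h.uz h.vx h.vy h.vz).trans
      (key v u h.uv.symm h.vx h.vy h.vz h.ux h.uy h.uz).symm)

/-- The octahedron. -/
def octahedron : SimpleGraph (Fin 6) where
  Adj i j := i / 2 ≠ j / 2
  symm := ⟨fun _ _ h => h.symm⟩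
  loopless := ⟨fun _ h => h rfl⟩

instance : DecidableRel octahedron.Adj := fun _ _ => inferInstanceAs (Decidable (¬ _))

theorem isGraphical_four : IsGraphical fun _ : Fin 6 => 4 := by
  refine ⟨octahedron, fun i => ?_⟩
  have : vdeg octahedron i = (Finset.univ.filter (octahedron.Adj i)).card :=
    le_antisymm (vdeg_le_card fun x hx => by simpa using hx)
      (card_le_vdeg fun x hx => by simpa using hx)
  change vdeg octahedron i = 4
  rw [this]
  clear this
  revert i
  decide

/-- In a 4-regular graph a spine end has no neighbour outside the book. The sixth vertex can then
see only the three pages, too few for degree 4. -/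
theorem not_isPotentially_four : ¬ IsPotentially (Kp11 3) fun _ : Fin 6 => 4 := by
  rintro ⟨K, hK, hc⟩
  obtain ⟨u, v, x, y, z, h⟩ := isContained_iff_hasBook.1 hc
  have hKd : ∀ i, vdeg K i = 4 := hK
  have c3 : ({x, y, z} : Finset (Fin 6)).card = 3 :=
    Finset.card_eq_three.2 ⟨x, y, z, h.xy, h.xz, h.yz, rfl⟩
  have c4 : ∀ t, K.Adj t x → K.Adj t y → K.Adj t z →
      ({t, x, y, z} : Finset (Fin 6)).card = 4 := fun t h1 h2 h3 => by
    rw [Finset.card_insert_of_notMem (by simp [h1.ne, h2.ne, h3.ne]), c3]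
  have hN : ∀ s t, K.Adj s t → K.Adj s x → K.Adj s y → K.Adj s z → K.Adj t x → K.Adj t y →
      K.Adj t z → ∀ a, K.Adj s a → a ∈ ({t, x, y, z} : Finset (Fin 6)) := by
    intro s t h1 h2 h3 h4 h5 h6 h7 a ha
    by_contra hna
    have : (insert a {t, x, y, z} : Finset (Fin 6)).card ≤ vdeg K s := card_le_vdeg (by
      simp only [Finset.mem_insert, Finset.mem_singleton]
      rintro b (rfl | rfl | rfl | rfl | rfl) <;> assumption)
    rw [Finset.card_insert_of_notMem hna, c4 t h5 h6 h7, hKd] at this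
    omega
  have hu := hN u v h.uv h.ux h.uy h.uz h.vx h.vy h.vz
  have hv := hN v u h.uv.symm h.vx h.vy h.vz h.ux h.uy h.uz
  have c5 : (insert u {v, x, y, z} : Finset (Fin 6)).card = 5 := by
    rw [Finset.card_insert_of_notMem (by simp [h.uv.ne, h.ux.ne, h.uy.ne, h.uz.ne]),
      c4 v h.vx h.vy h.vz]
  obtain ⟨w, -, hw⟩ := Finset.exists_mem_notMem_of_card_lt_card
    (s := insert u {v, x, y, z}) (t := (Finset.univ : Finset (Fin 6))) (by rw [c5]; simp)
  have : vdeg K w ≤ ({x, y, z} : Finset (Fin 6)).card := vdeg_le_card fun a ha => by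
    have h1 : ∀ b ∈ ({u, v, x, y, z} : Finset (Fin 6)), K.Adj w b → b ∈ ({x, y, z} : Finset _) := by
      intro b hb hwb
      have h1 := hu w
      have h2 := hv w
      have h3 := hwb.symm
      simp only [Finset.mem_insert, Finset.mem_singleton] at *
      grind
    refine h1 a ?_ ha
    by_contra hna
    have h6 : (insert w (insert a {u, v, x, y, z}) : Finset (Fin 6)).card ≤ 6 := by
      simpa using Finset.card_le_univ (insert w (insert a {u, v, x, y, z}) : Finset (Fin 6))
    rw [Finset.card_insert_of_notMem, Finset.card_insert_of_notMem hna, c5] at h6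
    · omega
    · rw [Finset.mem_insert, not_or]
      exact ⟨ha.ne, hw⟩
  rw [hKd, c3] at this
  omega

theorem theorem2 :
    (∀ n : ℕ, n = 5 ∨ 7 ≤ n → IsPotentialNumber (Kp11 3) n (4 * n - 2)) ∧
    (∀ S : Fin 6 → ℕ, IsGraphical S → 22 ≤ ∑ i, S i →
      (IsPotentially (Kp11 3) S ∨ S = fun _ => 4)) ∧
    (IsGraphical (fun _ : Fin 6 => 4) ∧ ¬ IsPotentially (Kp11 3) (fun _ : Fin 6 => 4)) ∧
    IsPotentialNumber (Kp11 3) 6 26 := by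
  refine ⟨fun n hn => ⟨⟨⟨2 * n - 1, by omega⟩, fun S hS hsum => ?_⟩, fun l ⟨⟨k, hk⟩, hl⟩ => ?_⟩,
    fun S hS hsum => ?_, ⟨isGraphical_four, not_isPotentially_four⟩,
    ⟨⟨⟨13, rfl⟩, fun S hS hsum => ?_⟩, fun l ⟨⟨k, hk⟩, hl⟩ => ?_⟩⟩
  · exact (isPotentially_or_of_sum_le (by omega) hS hsum).resolve_right (by omega)
  · by_contra! hlt
    obtain ⟨S, hS, hsum, hnot⟩ := exists_wheel_sequence (n := n) (by omega)
    -- Evenness turns `l < 4n - 2` into `l ≤ 4n - 4`, the degree sum of the wheel.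
    exact hnot (hl S hS (by omega))
  · exact (isPotentially_or_of_sum_le le_add_self hS hsum).imp_right fun h => funext h.2
  · refine (isPotentially_or_of_sum_le (by norm_num) hS (by omega)).resolve_right fun h => ?_
    simp [h.2] at hsum
  · by_contra! hlt
    exact not_isPotentially_four (hl _ isGraphical_four (by simp; omega))
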